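/- Let $\mathbb{K}$ be an algebraically closed field, let $\underline{t}=(t_1,t_2,t_3)$ and $\underline{X}=(X_1,X_2,X_3,X_4)$ be variables, and let $d>2$. Let $u_1,u_2,u_3,u_4\in\mathbb{K}[\underline{t}]$ be nonzero homogeneous polynomials of degree $d$ with $\gcd(u_1,u_2,u_3,u_4)=1$, such that the ideal $\mathcal{I}=\langle u_1,u_2,u_3,u_4\rangle$ is saturated with respect to $\langle t_1,t_2,t_3\rangle$. Suppose that the syzygy module $\mathrm{Syz}(\mathcal{I})=\{(a_1,\dots,a_4)\in\mathbb{K}[\underline{t}]^4:\ \sum_j a_ju_j=0\}$ has a $\mathbb{K}[\underline{t}]$-basis $\{a^{(1)},a^{(2)},a^{(3)}\}$ whose members have homogeneous entries of degrees $\mu_1=1$, $\mu_2=1$ and $\mu_3=d-2$ respectively, and put $p_i(\underline{t},\underline{X})=\sum_{j=1}^4 a^{(i)}_j(\underline{t})X_j\in\mathbb{K}[\underline{t},\underline{X}]$. Let $\mathrm{S}\subset\mathbb{P}^3$ be the Zariski closure of the image of the rational map $\mathbb{P}^2\dashrightarrow\mathbb{P}^3$, $\underline{t}\mapsto(u_1(\underline{t}):u_2(\underline{t}):u_3(\underline{t}):u_4(\underline{t}))$.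 If $\mathrm{S}$ is a surface of degree $\deg(\mathrm{S})\geq 3$ (the degree of its implicit equation, i.e. of the generator of its homogeneous ideal), then the ideal $\mathcal{N}=\langle p_1,p_2\rangle\subset\mathbb{K}[\underline{t},\underline{X}]$ is prime. -/

import Mathlib

noncomputable section

namespace MovingPlanes

open MvPolynomial
open scoped LinearAlgebra.Projectivization

variable {K : Type*} [Field K]

/-- The syzygy module of the sequence `u`: all `a` with `∑ i, a i * u i = 0`. -/
def syz {m n : ℕ} (u : Fin m → MvPolynomial (Fin n) K) :
    Submodule (MvPolynomial (Fin n) K) (Fin m → MvPolynomial (Fin n) K) :=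
  LinearMap.ker (Fintype.linearCombination (MvPolynomial (Fin n) K) u)

/-- The polynomial `∑ j, a_j(t) X_j` of `K[t, X]` attached to `a`; the variables `t` are indexed by
the left summand and the variables `X` by the right one. -/
def movingPlane {m n : ℕ} (a : Fin m → MvPolynomial (Fin n) K) :
    MvPolynomial (Fin n ⊕ Fin m) K :=
  ∑ j, rename Sum.inl (a j) * X (Sum.inr j)

/-- The ideal is saturated with respect to the ideal `𝔪` generated by the variables:
`I : 𝔪 ^ ∞ = I`. -/
def IsSaturated {n : ℕ} (I : Ideal (MvPolynomial (Fin n) K)) : Prop :=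
  ∀ f : MvPolynomial (Fin n) K,
    (∃ k : ℕ, ∀ g ∈ (Ideal.span (Set.range (X : Fin n → MvPolynomial (Fin n) K))) ^ k,
      g * f ∈ I) → f ∈ I

/-- The affine cone, without its vertex, over a set of points of projective space. -/
def affineCone {m : ℕ} (Z : Set (ℙ K (Fin m → K))) : Set (Fin m → K) :=
  {v | ∃ hv : v ≠ 0, Projectivization.mk K v hv ∈ Z}

/-- The Zariski closure of a set of points of projective space: the common zeros of all
homogeneous polynomials that vanish on it. -/
def zariskiClosure {m : ℕ} (Z : Set (ℙ K (Fin m → K))) : Set (ℙ K (Fin m → K)) :=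
  {P | ∀ (k : ℕ) (f : MvPolynomial (Fin m) K), f.IsHomogeneous k →
    (∀ v ∈ affineCone Z, eval v f = 0) → ∀ v ∈ affineCone {P}, eval v f = 0}

/-- The image of the rational map `t ↦ (u_1(t) : ... : u_m(t))`, which is defined at the points
where the `u_i` do not all vanish. -/
def ratImage {m n : ℕ} (u : Fin m → MvPolynomial (Fin n) K) : Set (ℙ K (Fin m → K)) :=
  {P | ∃ t : Fin n → K, t ≠ 0 ∧ ∃ h : (fun i => eval t (u i)) ≠ 0,
    P = Projectivization.mk K (fun i => eval t (u i)) h}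

/-- The variety parametrized by `u`. -/
def paramVariety {m n : ℕ} (u : Fin m → MvPolynomial (Fin n) K) : Set (ℙ K (Fin m → K)) :=
  zariskiClosure (ratImage u)

/-- `S` is a hypersurface of degree `δ`: its ideal is generated by one non-constant polynomial
(its implicit equation), and `δ` is the degree of this polynomial. -/
def IsHypersurfaceOfDegree {m : ℕ} (S : Set (ℙ K (Fin m → K))) (δ : ℕ) : Prop :=
  ∃ E : MvPolynomial (Fin m) K, E ≠ 0 ∧ ¬ IsUnit E ∧
    vanishingIdeal K (affineCone S) = Ideal.span {E} ∧ E.totalDegree = δ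

end MovingPlanes

end

noncomputable section

namespace MovingPlanes

open MvPolynomial

/-! Read `p₁`, `p₂` as linear forms in `X` over the factorial ring `K[t]`, and let `τ` be a nonzero
coefficient of `p₁`: a linear form in `t`, hence prime. Once `τ` is inverted, `p₁ = 0` eliminates
one of the `X`, and `p₂` becomes a linear form whose coefficients are `2 × 2` minors. The minors of
two members of a syzygy basis have no common prime factor (`exists_minor_not_dvd`), so up to a power
of `τ` this form is primitive, hence prime. Therefore `N` is prime as soon as `τ` is regular modulo
`N` (`isPrime_span_linForm_pair`), and this holds if `p₁`, `p₂` stay coprime on the line `τ = 0`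
(`mem_of_C_mul_mem`).

A common factor on that line either involves `X`, and then `τ` divides all minors, or lies in
`K[t]`, and then all coefficients lie in the span of `τ` and one form `s`
(`isRelPrime_map_linForm`). In the second case `p₁ = s L + τ L'` and `p₂ = s M + τ M'`, so the
quadric `L M' - L' M` vanishes on `S`. As `deg S ≥ 3`, it is zero; then `p₁`, `p₂` are proportional
or all coefficients share a linear factor, against the coprimality of the minors
(`not_span_two_forms`). -/

/-- A divisor of a nonzero linear form is a constant or has a constant as its cofactor. -/
lemma exists_C_of_mul_isHomogeneous_one {R ι : Type*} [CommRing R] [IsDomain R]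
    {f g : MvPolynomial ι R}
    (h : (f * g).IsHomogeneous 1) (h0 : f * g ≠ 0) : (∃ r, f = C r) ∨ ∃ r, g = C r := by
  have hd := h.totalDegree h0
  rw [totalDegree_mul_of_isDomain (left_ne_zero_of_mul h0) (right_ne_zero_of_mul h0)] at hd
  rcases (by omega : f.totalDegree = 0 ∨ g.totalDegree = 0) with hf | hg
  · exact .inl ⟨_, totalDegree_eq_zero_iff_eq_C.1 hf⟩
  · exact .inr ⟨_, totalDegree_eq_zero_iff_eq_C.1 hg⟩

attribute [local instance] MvPolynomial.gradedAlgebra in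
/-- The components of a multiple of a homogeneous polynomial are multiples of it. -/
lemma dvd_homogeneousComponent {R ι : Type*} [CommRing R]
    {q f : MvPolynomial ι R} {n : ℕ} (hq : q.IsHomogeneous n)
    (h : q ∣ f) (k : ℕ) : q ∣ homogeneousComponent k f := by
  rw [← Ideal.mem_span_singleton] at h ⊢
  refine homogeneousComponent_mem_of_mem (Ideal.homogeneous_span _ _ ?_) h k
  rintro x rfl
  exact ⟨n, hq⟩

/-- A primitive linear form is irreducible. -/
lemma irreducible_of_isHomogeneous_one {R ι : Type*} [CommRing R]
    [IsDomain R] [WfDvdMonoid R] {f : MvPolynomial ι R}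
    (hf : f.IsHomogeneous 1) (h0 : f ≠ 0) (hprim : ∀ r : R, Irreducible r → ¬ C r ∣ f) :
    Irreducible f := by
  have key : ∀ r : R, C r ∣ f → IsUnit (C r : MvPolynomial ι R) := by
    intro r hr
    refine IsUnit.map C ?_
    by_contra hu
    have hr0 : r ≠ 0 := by
      rintro rfl
      exact h0 (by simpa using hr)
    obtain ⟨p, hp, hpr⟩ := WfDvdMonoid.exists_irreducible_factor hu hr0
    exact hprim p hp ((map_dvd C hpr).trans hr)
  refine ⟨fun hu => ?_, fun {x y} hxy => ?_⟩
  · have := (isUnit_iff_totalDegree_of_isReduced.1 hu).2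
    rw [hf.totalDegree h0] at this
    omega
  · subst hxy
    rcases exists_C_of_mul_isHomogeneous_one hf h0 with ⟨r, rfl⟩ | ⟨r, rfl⟩
    · exact .inl (key r (dvd_mul_right _ _))
    · exact .inr (key r (dvd_mul_left _ _))

/-! ### Linear forms over a commutative ring. -/

section LinearForms

variable {R ι : Type*} [CommRing R] [Fintype ι]

/-- The linear form `∑ j, a j * X j`. -/
def linForm (a : ι → R) : MvPolynomial ι R := ∑ j, C (a j) * X j

lemma linForm_isHomogeneous (a : ι → R) : (linForm a).IsHomogeneous 1 :=
  IsHomogeneous.sum _ _ _ fun _ _ => isHomogeneous_C_mul_X _ _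

lemma coeff_linForm (a : ι → R) (j : ι) : coeff (Finsupp.single j 1) (linForm a) = a j := by
  classical
  simp [linForm, coeff_sum, coeff_C_mul, coeff_X, Finsupp.single_left_inj]

lemma linForm_injective : Function.Injective (linForm : (ι → R) → MvPolynomial ι R) := by
  intro a c h
  funext j
  rw [← coeff_linForm a, h, coeff_linForm]

lemma linForm_zero : linForm (0 : ι → R) = 0 := by simp [linForm]

lemma linForm_smul (r : R) (a : ι → R) : linForm (r • a) = C r * linForm a := by
  simp [linForm, Finset.mul_sum, mul_assoc]

/-- A homogeneous polynomial of degree one is a linear form. -/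
lemma eq_linForm_of_isHomogeneous {f : MvPolynomial ι R} (hf : f.IsHomogeneous 1) :
    f = linForm fun j => coeff (Finsupp.single j 1) f := by
  ext m
  by_cases hm : m.degree = 1
  · obtain ⟨j, rfl⟩ : ∃ j, m = Finsupp.single j 1 := by
      have : m ∈ Set.range fun i : ι => Finsupp.single i 1 := by rwa [Finsupp.range_single_one]
      exact this.imp fun _ h => h.symm
    rw [coeff_linForm]
  · rw [hf.coeff_eq_zero hm, (linForm_isHomogeneous _).coeff_eq_zero hm]

lemma C_dvd_linForm_iff (r : R) (a : ι → R) : C r ∣ linForm a ↔ ∀ j, r ∣ a j := by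
  constructor
  · intro h j
    rw [← coeff_linForm a j]
    exact (C_dvd_iff_dvd_coeff _ _).1 h _
  · intro h
    exact Finset.dvd_sum fun j _ => Dvd.dvd.mul_right (map_dvd C (h j)) _

lemma map_linForm {S : Type*} [CommRing S] (φ : R →+* S) (a : ι → R) :
    map φ (linForm a) = linForm fun j => φ (a j) := by
  simp [linForm]

end LinearForms

/-! ### Primality by elimination of one variable. -/

section PrimeIdeal

variable {R ι : Type*} [CommRing R] [Fintype ι]

/-- The substitution that eliminates `X j₀` by means of the equation `linForm a = 0`. -/
def elim [DecidableEq ι] (a : ι → R) (j₀ : ι) : MvPolynomial ι R →ₐ[R] MvPolynomial ι R :=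
  -- Scaling every variable by `a j₀` clears the denominator in `X j₀ = -(∑ j ≠ j₀, a j * X j) / a
  -- j₀`, so no localization is needed.
  aeval fun j => C (a j₀) * X j - if j = j₀ then linForm a else 0

lemma elim_isHomogeneous [DecidableEq ι] (a : ι → R) (j₀ : ι) {f : MvPolynomial ι R} {k : ℕ}
    (hf : f.IsHomogeneous k) : (elim a j₀ f).IsHomogeneous k := by
  have := hf.aeval (fun j => C (a j₀) * X j - if j = j₀ then linForm a else 0) (n := 1) ?_
  · simpa [elim] using this
  · intro j
    refine (isHomogeneous_C_mul_X _ _).sub ?_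
    split_ifs
    · exact linForm_isHomogeneous a
    · exact isHomogeneous_zero _ _ _

lemma elim_linForm [DecidableEq ι] (a c : ι → R) (j₀ : ι) :
    elim a j₀ (linForm c) = C (a j₀) * linForm c - C (c j₀) * linForm a := by
  have : elim a j₀ (linForm c) =
      ∑ j, C (c j) * (C (a j₀) * X j - if j = j₀ then linForm a else 0) := by
    simp [elim, linForm]
  rw [this]
  simp only [mul_sub, Finset.sum_sub_distrib, mul_ite, mul_zero, Finset.sum_ite_eq',
    Finset.mem_univ, if_true]
  congr 1
  rw [linForm, Finset.mul_sum]
  exact Finset.sum_congr rfl fun j _ => by ring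

/-- Modulo `linForm a`, elimination multiplies a form of degree `k` by `a j₀ ^ k`. -/
lemma elim_sub_mem [DecidableEq ι] (a : ι → R) (j₀ : ι) {f : MvPolynomial ι R} {k : ℕ}
    (hf : f.IsHomogeneous k) :
    elim a j₀ f - C (a j₀) ^ k * f ∈ Ideal.span {linForm a} := by
  have hm : ∀ m : ι →₀ ℕ, elim a j₀ (monomial m 1) - C (a j₀) ^ m.degree * monomial m 1 ∈
      Ideal.span {linForm a} := by
    intro m
    induction m using Finsupp.induction_linear with
    | zero => simp
    | add m n ihm ihn =>
      have e : (monomial (m + n) 1 : MvPolynomial ι R) = monomial m 1 * monomial n 1 := by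
        simp [monomial_mul]
      rw [e, map_mul, map_add, pow_add]
      have := Ideal.add_mem _ (Ideal.mul_mem_right (elim a j₀ (monomial n 1)) _ ihm)
        (Ideal.mul_mem_right (C (a j₀) ^ m.degree * monomial m 1) _ ihn)
      convert this using 1
      ring
    | single i n =>
      rw [← X_pow_eq_monomial, map_pow, Finsupp.degree_single, ← mul_pow]
      refine Ideal.mem_of_dvd _ (sub_dvd_pow_sub_pow _ _ n) ?_
      rw [elim, aeval_X, sub_sub_cancel_left]
      split_ifs
      · exact neg_mem (Ideal.mem_span_singleton_self _)
      · simp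
  have hs : elim a j₀ f - C (a j₀) ^ k * f = ∑ m ∈ f.support,
      C (coeff m f) * (elim a j₀ (monomial m 1) - C (a j₀) ^ m.degree * monomial m 1) := by
    conv_lhs => rw [f.as_sum]
    rw [map_sum, Finset.mul_sum, ← Finset.sum_sub_distrib]
    refine Finset.sum_congr rfl fun m hm' => ?_
    have e : monomial m (coeff m f) = C (coeff m f) * monomial m 1 := by simp [C_mul_monomial]
    have hk : m.degree = k := by
      by_contra h
      exact (mem_support_iff.1 hm') (hf.coeff_eq_zero h)
    rw [e, map_mul, hk, mul_sub]
    simp [elim]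
    ring
  rw [hs]
  exact Ideal.sum_mem _ fun m _ => Ideal.mul_mem_left _ _ (hm m)

/-- Two linear forms over a factorial ring generate a prime ideal if their `2 × 2` minors have no
common prime factor and some prime coefficient is regular modulo the ideal. -/
theorem isPrime_span_linForm_pair [IsDomain R] [UniqueFactorizationMonoid R] (a c : ι → R)
    (j₀ : ι) (hprime : Prime (a j₀))
    (hmin : ∀ h : R, Prime h → ∃ i j, ¬ h ∣ a i * c j - a j * c i)
    (hreg : ∀ f, C (a j₀) * f ∈ Ideal.span {linForm a, linForm c} →
      f ∈ Ideal.span {linForm a, linForm c}) :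
    (Ideal.span {linForm a, linForm c}).IsPrime := by
  classical
  set N := Ideal.span {linForm a, linForm c} with hN
  have ha : linForm a ∈ N := Ideal.subset_span (by simp)
  have hc : linForm c ∈ N := Ideal.subset_span (by simp)
  have haN : Ideal.span {linForm a} ≤ N := Ideal.span_mono (by simp)
  set q : MvPolynomial ι R := C (a j₀) * linForm c - C (c j₀) * linForm a with hq
  have hqlin : q = linForm fun j => a j₀ * c j - c j₀ * a j := by
    simp only [hq, linForm, Finset.mul_sum, ← Finset.sum_sub_distrib]
    refine Finset.sum_congr rfl fun j _ => ?_
    simp only [map_sub, map_mul]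
    ring
  have hqhom : q.IsHomogeneous 1 := hqlin ▸ linForm_isHomogeneous _
  -- The coefficients of `q` are the minors through column `j₀`; by a Plücker relation, `a j₀` times
  -- any minor is a combination of them.
  have hdvd : ∀ h : R, Prime h → ¬ h ∣ a j₀ → ¬ C h ∣ q := by
    intro h hh hha hhq
    rw [hqlin, C_dvd_linForm_iff] at hhq
    obtain ⟨i, j, hij⟩ := hmin h hh
    refine hij ((hh.dvd_or_dvd ?_).resolve_left hha)
    have : a j₀ * (a i * c j - a j * c i) =
        a i * (a j₀ * c j - c j₀ * a j) - a j * (a j₀ * c i - c j₀ * a i) := by ring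
    rw [this]
    exact dvd_sub (Dvd.dvd.mul_left (hhq j) _) (Dvd.dvd.mul_left (hhq i) _)
  have hq0 : q ≠ 0 := by
    intro h0
    obtain ⟨i, j, hij⟩ := hmin _ hprime
    have hz : ∀ j, a j₀ * c j - c j₀ * a j = 0 := by
      rw [hqlin, ← linForm_zero] at h0
      exact fun j => congrFun (linForm_injective h0) j
    have : a j₀ * (a i * c j - a j * c i) = 0 := by
      linear_combination a i * hz j - a j * hz i
    rcases mul_eq_zero.1 this with h | h
    · exact hprime.ne_zero h
    · exact hij (h ▸ dvd_zero _)
  have hCprime : Prime (C (a j₀) : MvPolynomial ι R) := (prime_C_iff ι).2 hprime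
  -- Only `a j₀` itself can be a prime factor of the content of `q`; dividing out its power leaves a
  -- primitive form.
  obtain ⟨q₀, hqq, hndvd⟩ :=
    (FiniteMultiplicity.of_prime_left hCprime hq0).exists_eq_pow_mul_and_not_dvd
  set e := multiplicity (C (a j₀)) q
  have hq₀0 : q₀ ≠ 0 := by
    rintro rfl
    exact hndvd (dvd_zero _)
  have hq₀hom : q₀.IsHomogeneous 1 := by
    intro m hm
    refine hqhom (d := m) ?_
    rw [hqq, ← C_pow, coeff_C_mul]
    exact mul_ne_zero (pow_ne_zero _ hprime.ne_zero) hm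
  have hq₀prime : Prime q₀ := by
    refine (irreducible_of_isHomogeneous_one hq₀hom hq₀0 fun r hr hrq => ?_).prime
    have hrp := hr.prime
    by_cases hra : r ∣ a j₀
    · have := (hrp.irreducible.associated_of_dvd hprime.irreducible hra).symm.dvd
      exact hndvd ((map_dvd C this).trans hrq)
    · exact hdvd r hrp hra (hqq ▸ hrq.mul_left _)
  have hpow : ∀ k f, C (a j₀) ^ k * f ∈ N → f ∈ N := by
    intro k
    induction k with
    | zero => intro f hf; simpa using hf
    | succ k ih =>
      intro f hf
      refine ih f (hreg _ ?_)
      rwa [pow_succ', mul_assoc] at hf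
  have hqN : q ∈ N := sub_mem (Ideal.mul_mem_left _ _ hc) (Ideal.mul_mem_left _ _ ha)
  -- Elimination kills `linForm a` and sends `linForm c` to `q`. Conversely, if `q₀` divides the
  -- image of `f`, then `a j₀ ^ (e + k) * f ∈ N` for `f` of degree `k`, and regularity cancels the
  -- power. The exponent depends on `k`, hence the passage to components.
  have hcomap : N = (Ideal.span {q₀}).comap (elim a j₀) := by
    refine le_antisymm ?_ fun f hf => ?_
    · rw [hN, Ideal.span_le]
      rintro x (rfl | rfl)
      · simp [elim_linForm]
      · simp only [SetLike.mem_coe, Ideal.mem_comap, elim_linForm, ← hq,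
          Ideal.mem_span_singleton]
        exact ⟨_, hqq.trans (mul_comm _ _)⟩
    · rw [Ideal.mem_comap, Ideal.mem_span_singleton] at hf
      rw [← sum_homogeneousComponent f]
      refine Ideal.sum_mem _ fun k _ => ?_
      have hcomp : elim a j₀ (homogeneousComponent k f) =
          homogeneousComponent k (elim a j₀ f) := by
        conv_rhs => rw [← sum_homogeneousComponent f, map_sum, map_sum]
        rw [Finset.sum_congr rfl fun i _ => homogeneousComponent_of_mem
          (elim_isHomogeneous a j₀ (homogeneousComponent_isHomogeneous i f)),
          Finset.sum_ite_eq]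
        split_ifs
        rfl
      have hd := dvd_homogeneousComponent hq₀hom hf k
      rw [← hcomp] at hd
      have h1 : C (a j₀) ^ e * elim a j₀ (homogeneousComponent k f) ∈ N :=
        Ideal.mem_of_dvd _ (hqq ▸ mul_dvd_mul_left _ hd) hqN
      have h2 := haN (elim_sub_mem a j₀ (homogeneousComponent_isHomogeneous k f))
      refine hpow (e + k) _ ?_
      have := sub_mem h1 (Ideal.mul_mem_left N (C (a j₀) ^ e) h2)
      convert this using 1
      ring
  rw [hcomap]
  have := (Ideal.span_singleton_prime hq₀0).2 hq₀prime
  exact Ideal.comap_isPrime _ _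

end PrimeIdeal

/-! ### Common factors and regularity modulo a hyperplane. -/

/-- If the forms of degree one `f k` have a common divisor `r` that is not a unit, then they are
proportional to one form of degree one. -/
lemma exists_eq_C_mul_of_dvd {K σ κ : Type*} [Field K]
    {f : κ → MvPolynomial σ K} {r : MvPolynomial σ K}
    (hr : ¬ IsUnit r) (hf : ∀ k, (f k).IsHomogeneous 1) (hrf : ∀ k, r ∣ f k) :
    ∃ (s : MvPolynomial σ K) (x : κ → K), s.IsHomogeneous 1 ∧ ∀ k, f k = C (x k) * s := by
  by_cases hz : ∀ k, f k = 0
  · exact ⟨0, 0, isHomogeneous_zero _ _ _, fun k => by simp [hz k]⟩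
  push Not at hz
  obtain ⟨k₀, hk₀⟩ := hz
  have hcof : ∀ k, ∃ y : K, f k = C y * r := by
    intro k
    by_cases hk : f k = 0
    · exact ⟨0, by simp [hk]⟩
    obtain ⟨g, hg⟩ := hrf k
    rcases exists_C_of_mul_isHomogeneous_one (hg ▸ hf k) (hg ▸ hk) with ⟨y, rfl⟩ | ⟨y, rfl⟩
    · refine absurd ((Ne.isUnit ?_).map C) hr
      rintro rfl
      exact hk (by simp [hg])
    · exact ⟨y, hg.trans (mul_comm _ _)⟩
  choose y hy using hcof
  refine ⟨r, y, ?_, hy⟩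
  have hy0 : y k₀ ≠ 0 := by
    intro h
    exact hk₀ (by rw [hy, h, C_0, zero_mul])
  have : r = C (y k₀)⁻¹ * f k₀ := by
    rw [hy, ← mul_assoc, ← C_mul, inv_mul_cancel₀ hy0, C_1, one_mul]
  rw [this]
  exact (hf k₀).C_mul _

/-- A nonzero form of degree one is prime. -/
lemma prime_of_isHomogeneous_one {K σ : Type*} [Field K] {τ : MvPolynomial σ K}
    (hτ : τ.IsHomogeneous 1) (h0 : τ ≠ 0) :
    Prime τ :=
  (irreducible_of_isHomogeneous_one hτ h0 fun _ hr => absurd hr.ne_zero.isUnit hr.not_isUnit).prime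

/-- If two linear forms are coprime modulo `τ`, then `τ` is regular modulo the ideal that they
generate. -/
lemma mem_of_C_mul_mem {R ι : Type*} [CommRing R] [IsDomain R] [UniqueFactorizationMonoid R]
    {p q : MvPolynomial ι R} {τ : R} (hτ0 : τ ≠ 0) {π : R →+* R} (hsub : ∀ f, τ ∣ f - π f)
    (hker : ∀ f, π f = 0 ↔ τ ∣ f) (hrel : IsRelPrime (map π p) (map π q)) (hp : map π p ≠ 0)
    {f : MvPolynomial ι R} (hf : C τ * f ∈ Ideal.span {p, q}) : f ∈ Ideal.span {p, q} := by
  obtain ⟨α, β, hαβ⟩ := Ideal.mem_span_pair.1 hf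
  have hidem : ∀ g : MvPolynomial ι R, map π (map π g) = map π g := by
    intro g
    ext m
    simp only [coeff_map]
    rw [← sub_eq_zero, ← map_sub, hker, dvd_sub_comm]
    exact hsub _
  have hdvd : ∀ g : MvPolynomial ι R, map π g = 0 → C τ ∣ g := by
    intro g hg
    rw [C_dvd_iff_dvd_coeff]
    intro m
    rw [← hker, ← coeff_map, hg, coeff_zero]
  have hrel0 : map π α * map π p + map π β * map π q = 0 := by
    rw [← map_mul, ← map_mul, ← map_add, hαβ, map_mul, map_C, (hker τ).2 dvd_rfl, C_0, zero_mul]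
  -- Modulo `τ`, the pair `(α, β)` is a syzygy of two coprime forms, hence `γ` times the Koszul
  -- syzygy `(-q, p)`. Subtracting the latter makes both coefficients divisible by `τ`.
  obtain ⟨γ, hγ⟩ : map π p ∣ map π β := by
    refine hrel.dvd_of_dvd_mul_right (z := map π q) ?_
    exact ⟨-map π α, by linear_combination hrel0⟩
  have hγ' : map π α = -(γ * map π q) := by
    refine mul_left_cancel₀ hp ?_
    linear_combination hrel0 - map π q * hγ
  obtain ⟨β', hβ'⟩ : C τ ∣ β - γ * p := by
    apply hdvd
    have := congrArg (map π) hγ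
    rw [hidem, map_mul, hidem] at this
    rw [map_sub, map_mul, this]
    ring
  obtain ⟨α', hα'⟩ : C τ ∣ α + γ * q := by
    apply hdvd
    have := congrArg (map π) hγ'
    rw [hidem, map_neg, map_mul, hidem] at this
    rw [map_add, map_mul, this]
    ring
  refine Ideal.mem_span_pair.2 ⟨α', β', ?_⟩
  refine mul_left_cancel₀ (C_ne_zero.2 hτ0) ?_
  linear_combination hαβ - p * hα' - q * hβ'

/-! ### Restriction to a hyperplane. -/

section Hyperplane

variable {K σ : Type*} [Field K] [Fintype σ]

/-- Restriction to the hyperplane `τ = 0`, as an endomorphism of the polynomial ring. -/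
lemma exists_restriction {τ : MvPolynomial σ K} (hτ : τ.IsHomogeneous 1) (h0 : τ ≠ 0) :
    ∃ π : MvPolynomial σ K →ₐ[K] MvPolynomial σ K, (∀ f, τ ∣ f - π f) ∧ (∀ f, π f = 0 ↔ τ ∣ f) ∧
      ∀ f, f.IsHomogeneous 1 → (π f).IsHomogeneous 1 := by
  classical
  set e : σ → K := fun j => coeff (Finsupp.single j 1) τ with he
  have hτe : τ = linForm e := eq_linForm_of_isHomogeneous hτ
  obtain ⟨i, hi⟩ : ∃ i, e i ≠ 0 := by
    by_contra! h
    exact h0 (by rw [hτe, funext h]; exact linForm_zero)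
  let π : MvPolynomial σ K →ₐ[K] MvPolynomial σ K :=
    aeval fun j => X j - if j = i then C (e i)⁻¹ * τ else 0
  have hπτ : π τ = 0 := by
    have : π τ = ∑ j, C (e j) * (X j - if j = i then C (e i)⁻¹ * τ else 0) := by
      conv_lhs => rw [hτe]
      simp only [linForm, map_sum, map_mul, π, aeval_X, algHom_C, algebraMap_eq]
    rw [this]
    simp only [mul_sub, Finset.sum_sub_distrib, mul_ite, mul_zero, Finset.sum_ite_eq',
      Finset.mem_univ, if_true]
    rw [← mul_assoc, ← C_mul, mul_inv_cancel₀ hi, C_1, one_mul, sub_eq_zero]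
    exact hτe.symm
  have hsub : ∀ f, τ ∣ f - π f := by
    intro f
    induction f using MvPolynomial.induction_on with
    | C r => simp
    | add f g hf hg =>
      rw [map_add, add_sub_add_comm]
      exact dvd_add hf hg
    | mul_X f j hf =>
      have hj : τ ∣ X j - π (X j) := by
        simp only [π, aeval_X, sub_sub_cancel]
        split_ifs
        · exact dvd_mul_left _ _
        · exact dvd_zero _
      have : f * X j - π (f * X j) = (f - π f) * X j + π f * (X j - π (X j)) := by
        rw [map_mul]; ring
      rw [this]
      exact dvd_add (hf.mul_right _) (hj.mul_left _)
  refine ⟨π, hsub, fun f => ⟨fun h => ?_, ?_⟩, fun f hf => ?_⟩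
  · simpa [h] using hsub f
  · rintro ⟨g, rfl⟩
    rw [map_mul, hπτ, zero_mul]
  · have := hf.aeval (fun j => X j - if j = i then C (e i)⁻¹ * τ else 0) (n := 1) ?_
    · simpa [π] using this
    · intro j
      refine (isHomogeneous_X _ _).sub ?_
      split_ifs
      · exact hτ.C_mul _
      · exact isHomogeneous_zero _ _ _

end Hyperplane

/-! ### Coefficients of degree one. -/

section Pencil

variable {K σ ι : Type*} [Field K] [Fintype ι]

/-- Restricted to a hyperplane, two linear forms whose coefficients are forms of degree one in the
parameters stay coprime. -/
lemma isRelPrime_map_linForm {a c : ι → MvPolynomial σ K} (ha : ∀ j, (a j).IsHomogeneous 1)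
    (hc : ∀ j, (c j).IsHomogeneous 1) {τ : MvPolynomial σ K}
    {π : MvPolynomial σ K →ₐ[K] MvPolynomial σ K} (hsub : ∀ f, τ ∣ f - π f)
    (hker : ∀ f, π f = 0 ↔ τ ∣ f)
    (hπ : ∀ f, f.IsHomogeneous 1 → (π f).IsHomogeneous 1) (hτ : τ.IsHomogeneous 1)
    (hmin : ∃ i j, ¬ τ ∣ a i * c j - a j * c i)
    (hspan : ∀ (s : MvPolynomial σ K) (x x' y y' : ι → K), s.IsHomogeneous 1 →
      (∀ j, a j = C (x j) * s + C (x' j) * τ) → (∀ j, c j = C (y j) * s + C (y' j) * τ) → False) :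
    IsRelPrime (map (π : MvPolynomial σ K →+* MvPolynomial σ K) (linForm a))
      (map (π : MvPolynomial σ K →+* MvPolynomial σ K) (linForm c)) := by
  rw [map_linForm, map_linForm]
  have hcase : ∀ (b : ι → MvPolynomial σ K) (h : MvPolynomial ι (MvPolynomial σ K)),
      h ∣ linForm b → (∃ r, h = C r) ∨ ∃ r, linForm b = C r * h := by
    rintro b h ⟨g, hg⟩
    by_cases h0 : linForm b = 0
    · exact .inr ⟨0, by simp [h0]⟩
    rcases exists_C_of_mul_isHomogeneous_one (hg ▸ linForm_isHomogeneous b) (hg ▸ h0)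
      with h | ⟨r, rfl⟩
    · exact .inl h
    · exact .inr ⟨r, hg.trans (mul_comm _ _)⟩
  have hconst : ∀ r : MvPolynomial σ K, C r ∣ linForm (fun j => (π : _ →+* _) (a j)) →
      C r ∣ linForm (fun j => (π : _ →+* MvPolynomial σ K) (c j)) →
      IsUnit (C r : MvPolynomial ι (MvPolynomial σ K)) := by
    intro r h1 h2
    rw [C_dvd_linForm_iff] at h1 h2
    refine IsUnit.map C ?_
    by_contra hr
    obtain ⟨s, x, hs, hx⟩ := exists_eq_C_mul_of_dvd (κ := ι ⊕ ι)
      (f := Sum.elim (fun j => π (a j)) fun j => π (c j)) hr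
      (by rintro (j | j); exacts [hπ _ (ha j), hπ _ (hc j)])
      (by rintro (j | j); exacts [h1 j, h2 j])
    have hlift : ∀ b : MvPolynomial σ K, b.IsHomogeneous 1 → ∃ z : K, b - π b = C z * τ := by
      intro b hb
      obtain ⟨g, hg⟩ := hsub b
      by_cases h0 : b - π b = 0
      · exact ⟨0, by simp [h0]⟩
      rcases exists_C_of_mul_isHomogeneous_one (hg ▸ hb.sub (hπ b hb)) (hg ▸ h0)
        with ⟨z, hz⟩ | ⟨z, rfl⟩
      · rw [hz] at hτ
        have hz0 : (C z : MvPolynomial σ K) ≠ 0 := by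
          rintro h
          rw [hz, h, zero_mul] at hg
          exact h0 hg
        exact absurd (hτ.inj_right (isHomogeneous_C σ z) hz0) one_ne_zero
      · exact ⟨z, hg.trans (mul_comm _ _)⟩
    choose x' hx' using fun j => hlift (a j) (ha j)
    choose y' hy' using fun j => hlift (c j) (hc j)
    refine hspan s (fun j => x (.inl j)) x' (fun j => x (.inr j)) y' hs (fun j => ?_) fun j => ?_
    · rw [← hx', ← hx (.inl j)]; simp
    · rw [← hy', ← hx (.inr j)]; simp
  intro h h1 h2
  rcases hcase _ h h1 with ⟨r, rfl⟩ | ⟨r, hr⟩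
  · exact hconst r h1 h2
  rcases hcase _ h h2 with ⟨s, rfl⟩ | ⟨s, hs⟩
  · exact hconst s h1 h2
  -- Both restricted forms are now multiples of the same `h` by elements of the base ring, so every
  -- minor vanishes modulo `τ`.
  obtain ⟨i, j, hij⟩ := hmin
  refine absurd ((hker _).1 ?_) hij
  have ea : ∀ j, π (a j) = r * coeff (Finsupp.single j 1) h := fun j => by
    rw [← coeff_C_mul, ← hr, coeff_linForm]; rfl
  have ec : ∀ j, π (c j) = s * coeff (Finsupp.single j 1) h := fun j => by
    rw [← coeff_C_mul, ← hs, coeff_linForm]; rfl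
  rw [map_sub, map_mul, map_mul, ea, ea, ec, ec]
  ring

/-- Two linear forms in `X` whose coefficients are forms of degree one in the parameters generate a
prime ideal if their `2 × 2` minors have no common prime factor and their coefficients are not
contained in the span of two forms. -/
theorem isPrime_span_linForm_pair_of_isHomogeneous [Fintype σ] {a c : ι → MvPolynomial σ K}
    (ha : ∀ j, (a j).IsHomogeneous 1) (hc : ∀ j, (c j).IsHomogeneous 1)
    (hmin : ∀ h : MvPolynomial σ K, Prime h → ∃ i j, ¬ h ∣ a i * c j - a j * c i)
    (hspan : ∀ (s τ : MvPolynomial σ K) (x x' y y' : ι → K), s.IsHomogeneous 1 →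
      τ.IsHomogeneous 1 → τ ≠ 0 →
      (∀ j, a j = C (x j) * s + C (x' j) * τ) → (∀ j, c j = C (y j) * s + C (y' j) * τ) → False)
    (ha0 : a ≠ 0) : (Ideal.span {linForm a, linForm c}).IsPrime := by
  obtain ⟨j₀, hj₀⟩ := Function.ne_iff.1 ha0
  have hτ := ha j₀
  have hprime := prime_of_isHomogeneous_one hτ hj₀
  obtain ⟨π, hsub, hker, hπ⟩ := exists_restriction hτ hj₀
  have hrel := isRelPrime_map_linForm ha hc hsub hker hπ hτ (hmin _ hprime)
    fun s x x' y y' hs => hspan s _ x x' y y' hs hτ hj₀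
  have hne : map (π : MvPolynomial σ K →+* MvPolynomial σ K) (linForm a) ≠ 0 := by
    rw [map_linForm]
    intro h0
    have hz : ∀ j, a j₀ ∣ a j := fun j =>
      (hker _).1 (congrFun (linForm_injective (h0.trans linForm_zero.symm)) j)
    obtain ⟨i, j, hij⟩ := hmin _ hprime
    exact hij (dvd_sub ((hz i).mul_right _) ((hz j).mul_right _))
  exact isPrime_span_linForm_pair a c j₀ hprime hmin fun f hf =>
    mem_of_C_mul_mem (R := MvPolynomial σ K) (p := linForm a) (q := linForm c) (τ := a j₀)
      (π := (π : MvPolynomial σ K →+* MvPolynomial σ K)) hj₀ hsub hker hrel hne hf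

end Pencil

/-! ### Syzygies, the implicit equation and moving planes. -/

section Syzygies

variable {K : Type*} [Field K] {m n : ℕ}

lemma mem_syz {u a : Fin m → MvPolynomial (Fin n) K} : a ∈ syz u ↔ ∑ j, a j * u j = 0 := by
  simp [syz, Fintype.linearCombination_apply]

/-- The `2 × 2` minors of two members of a basis of a syzygy module have no common prime factor. -/
lemma exists_minor_not_dvd {κ : Type*} {u : Fin m → MvPolynomial (Fin n) K}
    (b : Module.Basis κ (MvPolynomial (Fin n) K) (syz u)) {k l : κ} (hkl : k ≠ l)
    {h : MvPolynomial (Fin n) K} (hh : Prime h) :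
    ∃ i j, ¬ h ∣ (b k : Fin m → MvPolynomial (Fin n) K) i *
        (b l : Fin m → MvPolynomial (Fin n) K) j -
      (b k : Fin m → MvPolynomial (Fin n) K) j * (b l : Fin m → MvPolynomial (Fin n) K) i := by
  -- A syzygy divisible by `h` is `h` times a syzygy, so its coordinates in the basis are divisible
  -- by `h` too.
  have hdiv : ∀ v : syz u, (∀ i, h ∣ (v : Fin m → MvPolynomial (Fin n) K) i) →
      ∀ p, h ∣ b.repr v p := by
    intro v hv p
    choose w hw using hv
    have hws : w ∈ syz u := by
      rw [mem_syz]
      refine mul_left_cancel₀ hh.ne_zero ?_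
      rw [mul_zero, Finset.mul_sum, ← mem_syz.1 v.2]
      exact Finset.sum_congr rfl fun j _ => by rw [hw]; ring
    have : v = h • (⟨w, hws⟩ : syz u) := by
      ext1
      funext i
      simp [hw]
    rw [this, map_smul]
    exact ⟨_, rfl⟩
  by_contra! hall
  by_cases hk : ∀ j, h ∣ (b k : Fin m → MvPolynomial (Fin n) K) j
  · have := hdiv _ hk k
    rw [b.repr_self, Finsupp.single_eq_same] at this
    exact hh.not_isUnit (isUnit_of_dvd_one this)
  · push Not at hk
    obtain ⟨j, hj⟩ := hk
    -- The entries of this syzygy are the minors through column `j`, while its coordinate at `l` is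
    -- the `j`-th entry of `b k`.
    have := hdiv ((b k : Fin m → MvPolynomial (Fin n) K) j • b l -
      (b l : Fin m → MvPolynomial (Fin n) K) j • b k) (fun i => by
        have e := hall j i
        simpa [mul_comm] using e) l
    rw [map_sub, map_smul, map_smul, b.repr_self, b.repr_self] at this
    simp [hkl] at this
    exact hj this

/-- A nonzero form that vanishes on a parametrized hypersurface has at least its degree. -/
lemma eq_zero_of_eval_param_eq_zero {u : Fin m → MvPolynomial (Fin n) K} {δ k : ℕ}
    (hS : IsHypersurfaceOfDegree (paramVariety u) δ) {q : MvPolynomial (Fin m) K}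
    (hq : q.IsHomogeneous k) (hk : k < δ) (hqu : aeval u q = 0) : q = 0 := by
  obtain ⟨E, hE0, -, hE, rfl⟩ := hS
  have hpt : ∀ t : Fin n → K, eval (fun i => eval t (u i)) q = 0 := by
    intro t
    have := congrArg (eval t) hqu
    rw [map_zero] at this
    rw [← this]
    have e : (eval t).comp (aeval u : MvPolynomial (Fin m) K →ₐ[K] _).toRingHom =
        eval (fun i => eval t (u i)) := by
      ext <;> simp
    rw [← e]; rfl
  have hmem : q ∈ vanishingIdeal K (affineCone (paramVariety u)) := by
    rw [mem_vanishingIdeal_iff]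
    rintro v ⟨hv, hP⟩
    rw [aeval_eq_eval]
    refine hP k q hq ?_ v ⟨hv, rfl⟩
    rintro w ⟨hw, t, -, hu, hwt⟩
    rw [Projectivization.mk_eq_mk_iff'] at hwt
    obtain ⟨r, rfl⟩ := hwt
    have : eval (r • fun i => eval t (u i)) q = r ^ k * eval (fun i => eval t (u i)) q := by
      rw [eval_eq', eval_eq', Finset.mul_sum]
      refine Finset.sum_congr rfl fun p hp => ?_
      have hdeg : p.degree = k := by
        by_contra h
        exact (mem_support_iff.1 hp) (hq.coeff_eq_zero h)
      simp only [Pi.smul_apply, smul_eq_mul, mul_pow, Finset.prod_mul_distrib]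
      rw [Finset.prod_pow_eq_pow_sum, ← Finsupp.degree_eq_sum, hdeg]
      ring
    rw [this, hpt, mul_zero]
  rw [hE, Ideal.mem_span_singleton] at hmem
  obtain ⟨g, rfl⟩ := hmem
  by_contra h0
  have := hq.totalDegree h0
  rw [totalDegree_mul_of_isDomain (left_ne_zero_of_mul h0) (right_ne_zero_of_mul h0)] at this
  omega

/-- On a hypersurface of degree at least three, the coefficients of two syzygies of degree one
without common factors of their minors are not contained in the span of two forms. -/
lemma not_span_two_forms {u a c : Fin m → MvPolynomial (Fin n) K} {δ : ℕ}
    (hS : IsHypersurfaceOfDegree (paramVariety u) δ) (hδ : 3 ≤ δ) (ha : a ∈ syz u)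
    (hc : c ∈ syz u)
    (hmin : ∀ h : MvPolynomial (Fin n) K, Prime h → ∃ i j, ¬ h ∣ a i * c j - a j * c i)
    {s τ : MvPolynomial (Fin n) K} (x x' y y' : Fin m → K) (hs : s.IsHomogeneous 1)
    (hτ : τ.IsHomogeneous 1) (hτ0 : τ ≠ 0) (hax : ∀ j, a j = C (x j) * s + C (x' j) * τ)
    (hcy : ∀ j, c j = C (y j) * s + C (y' j) * τ) : False := by
  have hprime := prime_of_isHomogeneous_one hτ hτ0
  have hsyz : ∀ z z' : Fin m → K, (fun j => C (z j) * s + C (z' j) * τ) ∈ syz u →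
      s * aeval u (linForm z) + τ * aeval u (linForm z') = 0 := by
    intro z z' h
    rw [mem_syz] at h
    rw [← h]
    simp only [linForm, map_sum, map_mul, aeval_X, algHom_C, algebraMap_eq, Finset.mul_sum,
      ← Finset.sum_add_distrib]
    exact Finset.sum_congr rfl fun j _ => by ring
  have h1 := hsyz x x' (by rwa [← funext hax])
  have h2 := hsyz y y' (by rwa [← funext hcy])
  -- The two syzygy relations have the nonzero solution `(s, τ)`, so their determinant vanishes at
  -- `u`; it has degree `2 < δ`.
  have hQ : linForm x * linForm y' - linForm x' * linForm y = 0 := by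
    refine eq_zero_of_eval_param_eq_zero hS (k := 1 + 1)
      (((linForm_isHomogeneous x).mul (linForm_isHomogeneous y')).sub
        ((linForm_isHomogeneous x').mul (linForm_isHomogeneous y))) (by omega) ?_
    refine mul_left_cancel₀ hτ0 ?_
    rw [map_sub, map_mul, map_mul]
    linear_combination aeval u (linForm x) * h2 - aeval u (linForm y) * h1
  by_cases hx : x = 0
  · have hcases : linForm x' = 0 ∨ linForm y = 0 := by
      rw [hx, linForm_zero, zero_mul, zero_sub, neg_eq_zero] at hQ
      exact mul_eq_zero.1 hQ
    obtain ⟨i, j, hij⟩ := hmin τ hprime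
    rcases hcases with h | h
    · obtain rfl : x' = 0 := linForm_injective (h.trans linForm_zero.symm)
      exact hij (by simp [hax, hx])
    · obtain rfl : y = 0 := linForm_injective (h.trans linForm_zero.symm)
      have hτa : ∀ j, τ ∣ a j := fun j => ⟨C (x' j), by simp [hax, hx, mul_comm]⟩
      exact hij (dvd_sub ((hτa i).mul_right _) ((hτa j).mul_right _))
  have hlx : linForm x ≠ 0 := fun h => hx (linForm_injective (h.trans linForm_zero.symm))
  have hscalar : ∀ z : Fin m → K, linForm x ∣ linForm z → ∃ k : K, z = k • x := by
    rintro z ⟨g, hg⟩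
    by_cases hz : linForm z = 0
    · exact ⟨0, by rw [zero_smul]; exact linForm_injective (hz.trans linForm_zero.symm)⟩
    have hd := (linForm_isHomogeneous z).totalDegree hz
    have hg0 : g ≠ 0 := by
      rintro rfl
      exact hz (by simp [hg])
    rw [hg, totalDegree_mul_of_isDomain hlx hg0, (linForm_isHomogeneous x).totalDegree hlx] at hd
    obtain hgC := totalDegree_eq_zero_iff_eq_C.1 (by omega : g.totalDegree = 0)
    refine ⟨coeff 0 g, linForm_injective ?_⟩
    rw [linForm_smul, hg, mul_comm, ← hgC]
  -- A vanishing determinant of linear forms with prime corner `linForm x` has proportional columns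
  -- or proportional rows.
  have hdvd : linForm x ∣ linForm x' * linForm y := ⟨linForm y', by linear_combination -hQ⟩
  rcases (prime_of_isHomogeneous_one (linForm_isHomogeneous x) hlx).dvd_or_dvd hdvd with h | h
  · obtain ⟨k, rfl⟩ := hscalar x' h
    obtain rfl : y' = k • y := by
      refine linForm_injective (mul_left_cancel₀ hlx ?_)
      rw [linForm_smul] at hQ ⊢
      linear_combination hQ
    have ha' : ∀ j, a j = (s + C k * τ) * C (x j) := fun j => by
      rw [hax]; simp only [Pi.smul_apply, smul_eq_mul, C_mul]; ring
    have hc' : ∀ j, c j = (s + C k * τ) * C (y j) := fun j => by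
      rw [hcy]; simp only [Pi.smul_apply, smul_eq_mul, C_mul]; ring
    by_cases h0 : s + C k * τ = 0
    · obtain ⟨i, j, hij⟩ := hmin τ hprime
      exact hij (by simp [ha', h0])
    · obtain ⟨i, j, hij⟩ := hmin _ (prime_of_isHomogeneous_one (hs.add (hτ.C_mul k)) h0)
      refine hij (dvd_sub ?_ ?_) <;> rw [ha', mul_assoc] <;> exact dvd_mul_right _ _
  · obtain ⟨k, rfl⟩ := hscalar y h
    obtain rfl : y' = k • x' := by
      refine linForm_injective (mul_left_cancel₀ hlx ?_)
      rw [linForm_smul] at hQ ⊢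
      linear_combination hQ
    have hc' : ∀ j, c j = C k * a j := fun j => by
      rw [hcy, hax]; simp only [Pi.smul_apply, smul_eq_mul, C_mul]; ring
    obtain ⟨i, j, hij⟩ := hmin τ hprime
    refine hij ?_
    rw [hc', hc', show a i * (C k * a j) - a j * (C k * a i) = 0 by ring]
    exact dvd_zero _

/-- Polynomials in the parameters and the coordinates, read as polynomials in the coordinates. -/
def coordEquiv (K : Type*) [Field K] (m n : ℕ) :
    MvPolynomial (Fin n ⊕ Fin m) K ≃ₐ[K] MvPolynomial (Fin m) (MvPolynomial (Fin n) K) :=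
  -- The swap is there because `sumAlgEquiv` puts the right summand into the coefficients.
  (renameEquiv K (Equiv.sumComm (Fin n) (Fin m))).trans (sumAlgEquiv K (Fin m) (Fin n))

lemma coordEquiv_movingPlane (a : Fin m → MvPolynomial (Fin n) K) :
    coordEquiv K m n (movingPlane a) = linForm a := by
  have hC : ∀ f : MvPolynomial (Fin n) K, coordEquiv K m n (rename Sum.inl f) = C f := by
    intro f
    induction f using MvPolynomial.induction_on with
    | C r => simp [coordEquiv]
    | add f g hf hg => rw [map_add, map_add, hf, hg, C_add]
    | mul_X f j hf => rw [map_mul, map_mul, hf, C_mul]; simp [coordEquiv]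
  rw [movingPlane, linForm, map_sum]
  refine Finset.sum_congr rfl fun j _ => ?_
  rw [map_mul, hC]
  simp [coordEquiv]

lemma isPrime_span_movingPlane_pair {a c : Fin m → MvPolynomial (Fin n) K}
    (h : (Ideal.span {linForm a, linForm c}).IsPrime) :
    (Ideal.span {movingPlane a, movingPlane c}).IsPrime := by
  have e : Ideal.span {movingPlane a, movingPlane c} =
      (Ideal.span {linForm a, linForm c}).comap (coordEquiv K m n) := by
    rw [← coordEquiv_movingPlane a, ← coordEquiv_movingPlane c,
      ← Set.image_pair (coordEquiv K m n), ← Ideal.map_span]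
    exact (Ideal.comap_map_of_bijective _ (coordEquiv K m n).bijective).symm
  rw [e]
  exact Ideal.comap_isPrime _ _

end Syzygies

end MovingPlanes

end

theorem proposition4p4 {K : Type*} [Field K] [IsAlgClosed K]
    (d : ℕ) (hd : 2 < d)
    (u : Fin 4 → MvPolynomial (Fin 3) K)
    (hu0 : ∀ i, u i ≠ 0)
    (huhom : ∀ i, (u i).IsHomogeneous d)
    (hgcd : ∀ q : MvPolynomial (Fin 3) K, (∀ i, q ∣ u i) → IsUnit q)
    (hsat : MovingPlanes.IsSaturated (Ideal.span (Set.range u)))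
    (b : Module.Basis (Fin 3) (MvPolynomial (Fin 3) K) (MovingPlanes.syz u))
    (hb0 : ∀ j, ((b 0 : Fin 4 → MvPolynomial (Fin 3) K) j).IsHomogeneous 1)
    (hb1 : ∀ j, ((b 1 : Fin 4 → MvPolynomial (Fin 3) K) j).IsHomogeneous 1)
    (hb2 : ∀ j, ((b 2 : Fin 4 → MvPolynomial (Fin 3) K) j).IsHomogeneous (d - 2))
    (δ : ℕ) (hS : MovingPlanes.IsHypersurfaceOfDegree (MovingPlanes.paramVariety u) δ)
    (hδ : 3 ≤ δ) :
    (Ideal.span {MovingPlanes.movingPlane (b 0 : Fin 4 → MvPolynomial (Fin 3) K),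
      MovingPlanes.movingPlane (b 1 : Fin 4 → MvPolynomial (Fin 3) K)}).IsPrime := by
  have hmin := fun (h : MvPolynomial (Fin 3) K) (hh : Prime h) =>
    MovingPlanes.exists_minor_not_dvd b (k := 0) (l := 1) (by decide) hh
  refine MovingPlanes.isPrime_span_movingPlane_pair
    (MovingPlanes.isPrime_span_linForm_pair_of_isHomogeneous hb0 hb1 hmin ?_ ?_)
  · intro s τ x x' y y' hs hτ hτ0 hax hcy
    exact MovingPlanes.not_span_two_forms hS hδ (b 0).2 (b 1).2 hmin x x' y y' hs hτ hτ0 hax hcy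
  · exact fun h => b.ne_zero 0 (Subtype.ext h)
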